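/- Let $m\ge 1$ be an integer, let $A=\mathbf{Z}/m\mathbf{Z}$ (additive group), and let $B\subset(\mathbf{Z}/m\mathbf{Z})^*$ be a cyclic subgroup, of order $r$, of the group of invertible residues modulo $m$. Let $B$ act on $A$ by multiplication and set $H=A\rtimes B$. Let $n$ be a natural number, let $\alpha\colon H\hookrightarrow \mathrm{SL}(n,\mathbf{C})$ and $\varphi\colon B\hookrightarrow\mathbf{C}^*$ be injective group homomorphisms, and set $G=\mathrm{SL}(n,\mathbf{C})\times\mathbf{C}^*$ with its usual (complex) topology. Define the embedding $\psi\colon H\hookrightarrow G$ by $\psi(a,b)=(\alpha(a,b),\varphi(b))$ for $(a,b)\in A\rtimes B$, and let $X=G/\psi(H)$ be the space of left cosets with the quotient topology, with base point the image of $1\in G$. Set $\zeta=\exp(2\pi i/r)$. Then $\zeta$ lies in $\varphi(B)$, and there is an isomorphism of groups $$\pi_1(X)\;\simeq\;(\mathbf{Z}/m\mathbf{Z})\rtimes_{\varphi^{-1}(\zeta)}\mathbf{Z},$$ where $\pi_1$ is the topological fundamental group, and where, for $b\in B$, $(\mathbf{Z}/m\mathbf{Z})\rtimes_b\mathbf{Z}$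 denotes the semidirect product in which the generator $1$ of $\mathbf{Z}$ acts on $\mathbf{Z}/m\mathbf{Z}$ by multiplication by $b$. -/

import Mathlib

/-- The automorphism `a ↦ u a` of the additive group `ℤ/mℤ` (written multiplicatively) given by
multiplication by a unit `u`. -/
def mulByUnit (m : ℕ) (u : (ZMod m)ˣ) : MulAut (Multiplicative (ZMod m)) where
  toFun a := Multiplicative.ofAdd ((u : ZMod m) * a.toAdd)
  invFun a := Multiplicative.ofAdd (((u⁻¹ : (ZMod m)ˣ) : ZMod m) * a.toAdd)
  left_inv a := by simp
  right_inv a := by simp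
  map_mul' a b := by simp [mul_add]

/-- The natural action by multiplication of a subgroup `B` of `(ℤ/mℤ)ˣ` on the additive
group `ℤ/mℤ`. -/
def unitsAction (m : ℕ) (B : Subgroup (ZMod m)ˣ) : B →* MulAut (Multiplicative (ZMod m)) where
  toFun b := mulByUnit m b
  map_one' := by ext a; simp [mulByUnit]
  map_mul' b c := by ext a; simp [mulByUnit, mul_assoc]

/-- The group `H = (ℤ/mℤ) ⋊ B`. -/
abbrev affineGroup (m : ℕ) (B : Subgroup (ZMod m)ˣ) : Type :=
  Multiplicative (ZMod m) ⋊[unitsAction m B] B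

/-- The group `(ℤ/mℤ) ⋊_b ℤ`, in which the generator `1` of `ℤ` acts on `ℤ/mℤ` by
multiplication by `b`. -/
abbrev semidirectInt (m : ℕ) (b : (ZMod m)ˣ) : Type :=
  Multiplicative (ZMod m) ⋊[zpowersHom (MulAut (Multiplicative (ZMod m))) (mulByUnit m b)]
    Multiplicative ℤ

/-- The topological group `G = SL(n, ℂ) × ℂˣ`. -/
abbrev ambientGroup (n : ℕ) : Type :=
  Matrix.SpecialLinearGroup (Fin n) ℂ × ℂˣ

/-- The homomorphism `ψ : H → G`, `ψ (a, b) = (α (a, b), φ b)`. -/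
def psiHom {m n : ℕ} {B : Subgroup (ZMod m)ˣ}
    (α : affineGroup m B →* Matrix.SpecialLinearGroup (Fin n) ℂ) (φ : B →* ℂˣ) :
    affineGroup m B →* ambientGroup n :=
  α.prod (φ.comp SemidirectProduct.rightHom)

/-!
The fundamental group of `X = G ⧸ ψ(H)` is computed from its universal cover
`E = SL(n, ℂ) × ℂ`, which maps onto `G = SL(n, ℂ) × ℂˣ` by the exponential in the second factor.
The preimage `Γ` of the finite group `ψ(H)` in `E` is discrete, so `E → X` is a covering with deck
group `Γ`; as `E` is simply connected, `π₁(X) ≃ Γ`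
(`nonempty_fundamentalGroup_quotient_mulEquiv`). A pair `(g, z)` lies in `Γ` when
`g = α (a, b')` and `exp z = φ b'`. The image of `φ` is the group of all `r`-th roots of unity, so
there is `b` with `φ b = exp (2πi/r)`, and then `z = 2πik/r`, `b' = b ^ k` for a unique integer `k`.
Hence `(a, k) ↦ (α (a, b ^ k), 2πik/r)` identifies `(ℤ/mℤ) ⋊_b ℤ` with `Γ`
(`semidirectIntToCover_injective`, `range_semidirectIntToCover`).

The simple connectedness of `SL(n, ℂ)` is obtained algebraically, without fibrations. A loop is a
matrix of determinant one over the ring `C(T, ℂ)` of functions on the circle. In this ring the units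
are dense, since a `C¹` curve does not fill the plane (`dense_isUnit_continuousMap_circle`);
therefore the ring has stable range one (`hasStableRangeOne_of_dense_isUnit`), and over such a ring
Gaussian elimination writes every matrix of determinant one as a product of transvections
(`Matrix.SpecialLinearGroup.elementarySubgroup_eq_top`). A product of transvections `1 + c E_{ij}`
is contracted to the identity by replacing each `c` with `t * c`, `t ∈ [0, 1]`.
-/

/-! ### Rings of stable range one and elementary matrices -/

/-- A commutative ring has stable range one if every unimodular pair `(a, b)` can be shortened:
some `a + c * b` is a unit. -/
def HasStableRangeOne (R : Type*) [CommRing R] : Prop :=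
  ∀ a b : R, IsCoprime a b → ∃ c, IsUnit (a + c * b)

/-- In a Bézout relation `p * a + q * b = 1`, replacing `p` by a nearby unit `u` keeps
`u * a + q * b` close to `1`, hence a unit, and so `a + (u⁻¹ * q) * b` is a unit. -/
theorem hasStableRangeOne_of_dense_isUnit {R : Type*} [NormedCommRing R] [CompleteSpace R]
    (h : Dense {x : R | IsUnit x}) : HasStableRangeOne R := by
  rintro a b ⟨p, q, hpq⟩
  have hopen : IsOpen {x : R | ‖(p - x) * a‖ < 1} :=
    isOpen_lt (by fun_prop) continuous_const
  obtain ⟨x, hx, hxu⟩ := h.inter_open_nonempty _ hopen ⟨p, by simp⟩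
  obtain ⟨u, rfl⟩ : IsUnit x := hxu
  have hunit : IsUnit (u * a + q * b) := by
    have : (u : R) * a + q * b = 1 - (p - u) * a := by linear_combination hpq
    rw [this]
    exact isUnit_one_sub_of_norm_lt_one hx
  refine ⟨↑u⁻¹ * q, ?_⟩
  have : a + ↑u⁻¹ * q * b = ↑u⁻¹ * (u * a + q * b) := by
    linear_combination (-a) * u.inv_mul
  rw [this]
  exact u⁻¹.isUnit.mul hunit

namespace Matrix.SpecialLinearGroup

variable {ι R : Type*} [Fintype ι] [DecidableEq ι] [CommRing R]

variable (ι R) in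
/-- The elementary subgroup of `SL(ι, R)`, generated by the transvections. -/
def elementarySubgroup : Subgroup (SpecialLinearGroup ι R) :=
  Subgroup.closure {g | ∃ (i j : ι) (hij : i ≠ j) (c : R), g = transvection hij c}

theorem transvection_mem_elementarySubgroup {i j : ι} (hij : i ≠ j) (c : R) :
    transvection hij c ∈ elementarySubgroup ι R :=
  Subgroup.subset_closure ⟨i, j, hij, c, rfl⟩

/-- `M` is the identity matrix outside of the block of rows and columns indexed by `s`. -/
def IsOneOutside (s : Finset ι) (M : Matrix ι ι R) : Prop :=
  ∀ i j, i ∉ s ∨ j ∉ s → M i j = (1 : Matrix ι ι R) i j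

theorem transvection_mul_apply {i j : ι} (hij : i ≠ j) (c : R) (M : SpecialLinearGroup ι R)
    (a b : ι) : (transvection hij c * M) a b = M a b + if a = i then c * M j b else 0 := by
  change (Matrix.transvection i j c * M.1) a b = _
  split_ifs with h
  · subst h
    exact transvection_mul_apply_same _ _ _ _ _
  · rw [transvection_mul_apply_of_ne _ _ _ _ h, add_zero]

theorem mul_transvection_apply {i j : ι} (hij : i ≠ j) (c : R) (M : SpecialLinearGroup ι R)
    (a b : ι) : (M * transvection hij c) a b = M a b + if b = j then c * M a i else 0 := by
  change (M.1 * Matrix.transvection i j c) a b = _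
  split_ifs with h
  · subst h
    exact mul_transvection_apply_same _ _ _ _ _
  · rw [mul_transvection_apply_of_ne _ _ _ _ h, add_zero]

/-- Multiplying on the left by elementary matrices, a combination of the rows in `t` is added to
the row `k`. -/
theorem exists_elementary_mul_add_row {k : ι} {t : Finset ι} (hk : k ∉ t) (y : ι → R)
    (M : SpecialLinearGroup ι R) : ∃ g ∈ elementarySubgroup ι R, ∀ i j,
      (g * M) i j = M i j + if i = k then ∑ l ∈ t, y l * M l j else 0 := by
  induction t using Finset.induction_on with
  | empty => exact ⟨1, one_mem _, by simp⟩
  | insert l t hl ih =>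
    simp only [Finset.mem_insert, not_or] at hk
    obtain ⟨g, hg, h⟩ := ih hk.2
    refine ⟨transvection hk.1 (y l) * g, mul_mem (transvection_mem_elementarySubgroup _ _) hg,
      fun i j ↦ ?_⟩
    rw [mul_assoc, transvection_mul_apply, h, h, if_neg (Ne.symm hk.1), Finset.sum_insert hl]
    split_ifs <;> ring

/-- Multiplying on the left by elementary matrices, multiples of the row `k` are added to the
rows in `t`. -/
theorem exists_elementary_mul_clear_col {k : ι} {t : Finset ι} (hk : k ∉ t) (y : ι → R)
    (M : SpecialLinearGroup ι R) : ∃ g ∈ elementarySubgroup ι R, ∀ i j,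
      (g * M) i j = M i j + if i ∈ t then y i * M k j else 0 := by
  induction t using Finset.induction_on with
  | empty => exact ⟨1, one_mem _, by simp⟩
  | insert l t hl ih =>
    simp only [Finset.mem_insert, not_or] at hk
    obtain ⟨g, hg, h⟩ := ih hk.2
    refine ⟨transvection (Ne.symm hk.1) (y l) * g,
      mul_mem (transvection_mem_elementarySubgroup _ _) hg, fun i j ↦ ?_⟩
    rw [mul_assoc, transvection_mul_apply, h, h, if_neg hk.2]
    by_cases hi : i = l
    · subst hi
      simp [hl]
    · simp [hi]

/-- Multiplying on the right by elementary matrices, multiples of the column `k` are added to the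
columns in `t`. -/
theorem exists_mul_elementary_clear_row {k : ι} {t : Finset ι} (hk : k ∉ t) (y : ι → R)
    (M : SpecialLinearGroup ι R) : ∃ g ∈ elementarySubgroup ι R, ∀ i j,
      (M * g) i j = M i j + if j ∈ t then y j * M i k else 0 := by
  induction t using Finset.induction_on with
  | empty => exact ⟨1, one_mem _, by simp⟩
  | insert l t hl ih =>
    simp only [Finset.mem_insert, not_or] at hk
    obtain ⟨g, hg, h⟩ := ih hk.2
    refine ⟨g * transvection hk.1 (y l),
      mul_mem hg (transvection_mem_elementarySubgroup _ _), fun i j ↦ ?_⟩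
    rw [← mul_assoc, mul_transvection_apply, h, h, if_neg hk.2]
    by_cases hj : j = l
    · subst hj
      simp [hl]
    · simp [hj]

/-- Over a ring of stable range one, left multiplication by elementary matrices supported in the
block `insert k s` produces an entry `1` in position `(k, k)`. -/
theorem exists_elementary_mul_pivot_eq_one (hR : HasStableRangeOne R) {k : ι} {s : Finset ι}
    (hk : k ∉ s) (hs : s.Nonempty) (M : SpecialLinearGroup ι R)
    (hM : IsOneOutside (insert k s) M.1) :
    ∃ g ∈ elementarySubgroup ι R, (g * M) k k = 1 ∧ IsOneOutside (insert k s) (g * M).1 := by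
  -- The `k`-th column is unimodular because `M⁻¹ * M = 1`.
  have hsum : ∑ i ∈ insert k s, M⁻¹ k i * M i k = 1 := by
    have h1 : (M⁻¹ * M) k k = 1 := by simp
    change ((M⁻¹).1 * M.1) k k = 1 at h1
    rw [mul_apply] at h1
    refine Eq.trans ?_ h1
    refine Finset.sum_subset (Finset.subset_univ _) fun i _ hi ↦ ?_
    have : M i k = 0 := by
      rw [show M i k = _ from hM i k (.inl hi), one_apply_ne]
      rintro rfl
      exact hi (Finset.mem_insert_self _ _)
    rw [this, mul_zero]
  rw [Finset.sum_insert hk] at hsum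
  obtain ⟨c, u, hu⟩ := hR (M k k) (∑ i ∈ s, M⁻¹ k i * M i k) ⟨M⁻¹ k k, 1, by rwa [one_mul]⟩
  obtain ⟨g, hg, hgM⟩ := exists_elementary_mul_add_row hk (fun i ↦ c * M⁻¹ k i) M
  obtain ⟨l, hl⟩ := hs
  have hkl : k ≠ l := fun h ↦ hk (h ▸ hl)
  have hgk : (g * M) k k = u := by
    rw [hgM, if_pos rfl, hu, Finset.mul_sum]
    simp only [mul_assoc]
  -- Use the unit to put a `1` below the pivot, and this `1` to normalize the pivot.
  refine ⟨transvection hkl (1 - (u : R)) * (transvection hkl.symm (↑u⁻¹ * (1 - (g * M) l k)) * g),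
    mul_mem (transvection_mem_elementarySubgroup _ _)
      (mul_mem (transvection_mem_elementarySubgroup _ _) hg), ?_, ?_⟩
  · rw [mul_assoc, mul_assoc, transvection_mul_apply, transvection_mul_apply,
      transvection_mul_apply, if_pos rfl, if_neg hkl, if_pos rfl, hgk]
    linear_combination (1 - (u : R)) * (1 - (g * M) l k) * u.inv_mul
  · have key : IsOneOutside (insert k s) (g * M).1 := by
      rintro i j hij
      refine (hgM i j).trans ?_
      rw [show M i j = _ from hM i j hij]
      split_ifs with hi
      · subst hi
        have hj : j ∉ insert i s := by simpa using hij
        rw [Finset.sum_eq_zero, add_zero]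
        intro l hl
        rw [show M l j = _ from hM l j (.inr hj), one_apply_ne, mul_zero]
        rintro rfl
        exact hj (Finset.mem_insert_of_mem hl)
      · rw [add_zero]
    have step : ∀ {i j : ι} (hij : i ≠ j) (c : R) (N : SpecialLinearGroup ι R),
        i ∈ insert k s → j ∈ insert k s → IsOneOutside (insert k s) N.1 →
        IsOneOutside (insert k s) (transvection hij c * N).1 := by
      intro i j hij c N hi hj hN a b hab
      refine (transvection_mul_apply hij c N a b).trans ?_
      rw [show N a b = _ from hN a b hab]
      split_ifs with ha
      · subst ha
        have hb : b ∉ insert k s := by simpa [hi] using hab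
        have hjb : j ≠ b := by
          rintro rfl
          exact hb hj
        rw [show N j b = _ from hN j b (.inr hb), one_apply_ne hjb, mul_zero, add_zero]
      · rw [add_zero]
    rw [mul_assoc, mul_assoc]
    have hks := Finset.mem_insert_self k s
    have hls := Finset.mem_insert_of_mem (b := k) hl
    exact step _ _ _ hks hls (step _ _ _ hls hks key)

/-- Over a ring of stable range one, Gaussian elimination works in every special linear group. -/
theorem elementarySubgroup_eq_top (hR : HasStableRangeOne R) :
    elementarySubgroup ι R = ⊤ := by
  suffices H : ∀ (s : Finset ι) (M : SpecialLinearGroup ι R), IsOneOutside s M.1 →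
      M ∈ elementarySubgroup ι R from
    eq_top_iff.2 fun M _ ↦ H Finset.univ M fun i j h ↦ by simp at h
  intro s
  induction s using Finset.induction_on with
  | empty =>
    intro M hM
    have : M = 1 := SpecialLinearGroup.ext _ _ fun i j ↦ hM i j (.inl (Finset.notMem_empty i))
    exact this ▸ one_mem _
  | insert k s hk ih =>
    intro M hM
    rcases s.eq_empty_or_nonempty with rfl | hs
    · -- Only the entry `(k, k)` can differ from the identity, and it is the determinant.
      have hdiag : M.1 = diagonal fun i ↦ M i i := by
        ext i j
        by_cases hij : i = j
        · subst hij
          simp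
        · rw [diagonal_apply_ne _ hij, ← one_apply_ne hij (α := R)]
          refine hM i j ?_
          simp only [Finset.mem_insert, Finset.notMem_empty, or_false]
          by_contra! h
          exact hij (h.1.trans h.2.symm)
      have hdet : ∏ i, M i i = 1 := by
        rw [← det_diagonal, ← hdiag, M.2]
      have hkk : M k k = 1 := by
        refine Eq.trans (Eq.symm ?_) hdet
        refine Finset.prod_eq_single k (fun i _ hi ↦ ?_) (by simp)
        exact (hM i i (.inl (by simpa using hi))).trans (one_apply_eq i)
      have : M = 1 := by
        refine SpecialLinearGroup.ext _ _ fun i j ↦ ?_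
        by_cases hi : i = k
        · by_cases hj : j = k
          · subst hi hj
            simpa using hkk
          · exact hM i j (.inr (by simpa using hj))
        · exact hM i j (.inl (by simpa using hi))
      exact this ▸ one_mem _
    · obtain ⟨g, hg, h1, hN⟩ := exists_elementary_mul_pivot_eq_one hR hk hs M hM
      rw [← Subgroup.mul_mem_cancel_left _ hg]
      generalize g * M = N at h1 hN
      obtain ⟨g', hg', h'⟩ := exists_elementary_mul_clear_col hk (fun i ↦ -N i k) N
      rw [← Subgroup.mul_mem_cancel_left _ hg']
      obtain ⟨g'', hg'', h''⟩ := exists_mul_elementary_clear_row hk (fun j ↦ -N k j) (g' * N)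
      rw [← Subgroup.mul_mem_cancel_right _ hg'']
      refine ih _ fun i j hij ↦ (h'' i j).trans ?_
      have hcol : (g' * N) i k = (1 : Matrix ι ι R) i k := by
        rw [h']
        by_cases his : i ∈ s
        · rw [if_pos his, h1, one_apply_ne (by rintro rfl; exact hk his)]
          ring
        · rw [if_neg his, add_zero]
          by_cases hik : i = k
          · subst hik
            simpa using h1
          · exact hN i k (.inl (by simp [hik, his]))
      rw [hcol]
      by_cases hik : i = k
      · subst hik
        rw [h', if_neg hk, one_apply_eq]
        split_ifs with hj
        · rw [one_apply_ne (by rintro rfl; exact hk hj)]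
          ring
        · by_cases hjk : j = i
          · subst hjk
            simpa using h1
          · rw [add_zero, add_zero]
            exact hN i j (.inr (by simp [hjk, hj]))
      · rw [one_apply_ne hik, mul_zero, ite_self, add_zero]
        by_cases hjk : j = k
        · subst hjk
          rw [hcol]
        · rw [h']
          have hN' : N i j = (1 : Matrix ι ι R) i j ∧ (i ∈ s → N k j = 0) := by
            by_cases his : i ∈ s
            · have hjs : j ∉ insert k s := by
                simpa [hjk, his] using hij
              refine ⟨hN i j (.inr hjs), fun _ ↦ (hN k j (.inr hjs)).trans ?_⟩
              exact one_apply_ne (Ne.symm hjk)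
            · exact ⟨hN i j (.inl (by simp [hik, his])), fun h ↦ absurd h his⟩
          rw [hN'.1]
          split_ifs with his
          · rw [hN'.2 his, mul_zero, add_zero]
          · rw [add_zero]

end Matrix.SpecialLinearGroup

/-! ### Nonvanishing functions on the circle -/

/-- Nonvanishing functions are dense among the complex functions on the circle: a trigonometric
polynomial is `C¹`, so its range has dense complement in `ℂ`, and a small constant makes it
nonvanishing. -/
theorem dense_isUnit_continuousMap_circle :
    Dense {f : C(UnitAddCircle, ℂ) | IsUnit f} := by
  intro f
  rw [Metric.mem_closure_iff]
  intro ε hε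
  have hf : f ∈ closure (Submodule.span ℂ (Set.range (fourier (T := 1))) :
      Set C(UnitAddCircle, ℂ)) := by
    rw [← Submodule.topologicalClosure_coe, span_fourier_closure_eq_top]
    trivial
  obtain ⟨g, hg, hfg⟩ := Metric.mem_closure_iff.1 hf (ε / 2) (half_pos hε)
  have hsmooth : ContDiff ℝ 1 fun x : ℝ ↦ g (x : UnitAddCircle) := by
    clear hfg
    induction hg using Submodule.span_induction with
    | mem g hg =>
      obtain ⟨n, rfl⟩ := hg
      simp only [fourier_coe_apply]
      exact ((contDiff_const.mul Complex.ofRealCLM.contDiff).div_const _).cexp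
    | zero => exact contDiff_const
    | add g h _ _ hg hh => exact hg.add hh
    | smul c g _ hg => exact contDiff_const.smul hg
  have hd := hsmooth.dense_compl_range_of_finrank_lt_finrank (by simp)
  obtain ⟨z, hz, hzε⟩ := Metric.mem_closure_iff.1 (hd 0) (ε / 2) (half_pos hε)
  refine ⟨g - ContinuousMap.const _ z, ?_, ?_⟩
  · refine (ContinuousMap.isUnit_iff_forall_ne_zero _).2 fun x hx ↦ hz ?_
    obtain ⟨x, rfl⟩ := QuotientAddGroup.mk_surjective x
    exact ⟨x, sub_eq_zero.1 hx⟩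
  · calc dist f (g - ContinuousMap.const _ z)
        ≤ dist f g + dist g (g - ContinuousMap.const _ z) := dist_triangle _ _ _
      _ < ε / 2 + ε / 2 := by
        refine add_lt_add_of_lt_of_le hfg ?_
        rw [dist_eq_norm, sub_sub_cancel]
        refine (ContinuousMap.norm_le _ (half_pos hε).le).2 fun _ ↦ ?_
        simpa using hzε.le
      _ = ε := add_halves ε

/-! ### Simple connectedness of the special linear group -/

namespace Matrix.SpecialLinearGroup

variable {X ι R : Type*} [TopologicalSpace X] [Fintype ι] [DecidableEq ι] [CommRing R]
  [TopologicalSpace R] [IsTopologicalRing R]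

/-- A matrix of determinant one with entries in the ring `C(X, R)`, seen as a continuous map
from `X` to `SL(ι, R)`. -/
def toContinuousMap : SpecialLinearGroup ι C(X, R) →* C(X, SpecialLinearGroup ι R) where
  toFun M :=
    { toFun x := map ((Pi.evalRingHom (fun _ : X ↦ R) x).comp ContinuousMap.coeFnRingHom) M
      continuous_toFun := continuous_induced_rng.2 <| continuous_matrix fun i j ↦
        (M i j).continuous }
  map_one' := by ext1 x; exact (map (n := ι) _).map_one
  map_mul' M N := by ext1 x; exact (map (n := ι) _).map_mul M N

theorem toContinuousMap_apply (M : SpecialLinearGroup ι C(X, R)) (x : X) (i j : ι) :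
    toContinuousMap M x i j = M i j x := rfl

theorem toContinuousMap_surjective :
    Function.Surjective (toContinuousMap (X := X) (ι := ι) (R := R)) := by
  intro f
  let M : Matrix ι ι C(X, R) := of fun i j ↦ ⟨fun x ↦ f x i j, by fun_prop⟩
  have hM : M.det = 1 := by
    ext x
    have h := RingHom.map_det
      ((Pi.evalRingHom (fun _ : X ↦ R) x).comp ContinuousMap.coeFnRingHom) M
    exact h.trans (f x).2
  refine ⟨⟨M, hM⟩, ?_⟩
  ext x i j
  rfl

end Matrix.SpecialLinearGroup

open Matrix.SpecialLinearGroup in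
/-- A product of transvections over `C(X, ℂ)` is null-homotopic: scale the off-diagonal entry of
each factor down to zero. -/
theorem homotopic_one_of_mem_elementarySubgroup {X ι : Type*} [TopologicalSpace X] [Fintype ι]
    [DecidableEq ι] {M : Matrix.SpecialLinearGroup ι C(X, ℂ)}
    (hM : M ∈ elementarySubgroup ι C(X, ℂ)) :
    ContinuousMap.Homotopic 1 (toContinuousMap M) := by
  induction hM using Subgroup.closure_induction with
  | mem M hM =>
    obtain ⟨i, j, hij, c, rfl⟩ := hM
    refine ⟨{
      toFun p := transvection hij ((p.1 : ℝ) * c p.2 : ℂ)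
      continuous_toFun := continuous_induced_rng.2 <| continuous_matrix fun a b ↦ ?_
      map_zero_left x := by simp
      map_one_left x := ?_ }⟩
    · change Continuous fun p : unitInterval × X ↦
        (1 : Matrix ι ι ℂ) a b + Matrix.single i j ((p.1 : ℝ) * c p.2 : ℂ) a b
      simp only [Matrix.single_apply]
      split_ifs <;> fun_prop
    · ext a b
      rw [toContinuousMap_apply, transvection_coe, transvection_coe]
      simp only [Matrix.add_apply, Matrix.one_apply, Matrix.single_apply]
      split_ifs <;> simp
  | one => rw [map_one]
  | mul M N _ _ hM hN =>
    obtain ⟨F⟩ := hM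
    obtain ⟨G⟩ := hN
    rw [map_mul]
    exact ⟨{ toContinuousMap := F.toContinuousMap * G.toContinuousMap
             map_zero_left x := by simp
             map_one_left x := by simp }⟩
  | inv M _ hM =>
    obtain ⟨F⟩ := hM
    rw [map_inv]
    exact ⟨{ toContinuousMap := F.toContinuousMap⁻¹
             map_zero_left x := by simp
             map_one_left x := by simp }⟩

/-- Every free loop in `SL(ι, ℂ)` is null-homotopic. -/
theorem homotopic_one_of_circle_specialLinearGroup {ι : Type*} [Fintype ι] [DecidableEq ι]
    (f : C(UnitAddCircle, Matrix.SpecialLinearGroup ι ℂ)) : ContinuousMap.Homotopic 1 f := by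
  obtain ⟨M, rfl⟩ := Matrix.SpecialLinearGroup.toContinuousMap_surjective f
  refine homotopic_one_of_mem_elementarySubgroup ?_
  rw [Matrix.SpecialLinearGroup.elementarySubgroup_eq_top
    (hasStableRangeOne_of_dense_isUnit dense_isUnit_continuousMap_circle)]
  trivial

/-- A topological group in which every free loop contracts to the constant loop at `1` is simply
connected: a free homotopy becomes a homotopy of based loops after translation, and for a
constant loop it gives a path to `1`. -/
theorem simplyConnectedSpace_of_homotopic_one {G : Type*} [TopologicalSpace G] [Group G]
    [IsTopologicalGroup G] (h : ∀ f : C(UnitAddCircle, G), ContinuousMap.Homotopic 1 f) :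
    SimplyConnectedSpace G := by
  rw [simply_connected_iff_loops_nullhomotopic]
  constructor
  · have key (x : G) : Joined 1 x := by
      obtain ⟨F⟩ := h (ContinuousMap.const _ x)
      exact ⟨{ toFun s := F (s, 0)
               source' := by simp
               target' := by simp }⟩
    exact ⟨⟨1⟩, fun x y ↦ (key x).symm.trans (key y)⟩
  · intro x γ
    -- The loop `γ`, as a map from the circle.
    let f : C(UnitAddCircle, G) :=
      ⟨AddCircle.liftIco 1 0 γ.extend, AddCircle.liftIco_zero_continuous (by simp)
        γ.continuous_extend.continuousOn⟩
    have hf (t : unitInterval) : f ((t : ℝ) : UnitAddCircle) = γ t := by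
      rcases t.2.2.lt_or_eq with ht | ht
      · exact (AddCircle.liftIco_zero_coe_apply ⟨t.2.1, ht⟩).trans (γ.extend_apply t.2)
      · have ht' : t = 1 := Subtype.ext ht
        have h10 : ((1 : ℝ) : UnitAddCircle) = ((0 : ℝ) : UnitAddCircle) := by
          simp
        subst ht'
        rw [Set.Icc.coe_one, h10]
        exact (AddCircle.liftIco_zero_coe_apply ⟨le_rfl, one_pos⟩).trans (by simp : γ.extend 0 = γ 1)
    have hf0 : f 0 = x := by simpa using hf 0
    have hf1 : f ((1 : ℝ) : UnitAddCircle) = x := by simpa using hf 1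
    have h10 : ((1 : ℝ) : UnitAddCircle) = 0 := AddCircle.coe_period (1 : ℝ)
    obtain ⟨F⟩ := h f
    refine Path.Homotopic.symm ⟨{
      toFun p := x * (F (p.1, 0))⁻¹ * F (p.1, ((p.2 : ℝ) : UnitAddCircle))
      continuous_toFun := by
        have : Continuous fun p : unitInterval × unitInterval ↦ ((p.2 : ℝ) : UnitAddCircle) :=
          (AddCircle.continuous_mk' 1).comp (by fun_prop)
        fun_prop
      map_zero_left t := by simp
      map_one_left t := by simp [hf, hf0]
      prop' s t ht := by
        rcases ht with rfl | rfl <;> simp [h10] }⟩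

/-- The product of `SL(ι, ℂ)` with the additive group `ℂ` is simply connected. -/
theorem simplyConnectedSpace_specialLinearGroup_prod (ι : Type*) [Fintype ι] [DecidableEq ι] :
    SimplyConnectedSpace (Matrix.SpecialLinearGroup ι ℂ × Multiplicative ℂ) := by
  refine simplyConnectedSpace_of_homotopic_one fun f ↦ ?_
  obtain ⟨F⟩ := homotopic_one_of_circle_specialLinearGroup (ContinuousMap.fst.comp f)
  exact ⟨{
    toFun p := (F p, Multiplicative.ofAdd ((p.1 : ℝ) * (f p.2).2.toAdd : ℂ))
    continuous_toFun := by
      refine F.continuous.prodMk (continuous_ofAdd.comp ?_)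
      have : Continuous fun p : unitInterval × UnitAddCircle ↦ (f p.2).2.toAdd :=
        continuous_toAdd.comp (by fun_prop)
      fun_prop
    map_zero_left x := by simp [Prod.ext_iff]
    map_one_left x := by simp }⟩

/-! ### Coverings of coset spaces -/

/-- For a discrete subgroup `Γ` of a simply connected group `E`, presented as the preimage of a
subgroup `S` under an open quotient homomorphism `q : E → G`, the composite `E → G → G ⧸ S` is a
covering with deck group `Γ` acting by right translation, so `π₁(G ⧸ S)` is `Γ`. -/
theorem nonempty_fundamentalGroup_quotient_mulEquiv {E G : Type*} [Group E] [TopologicalSpace E]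
    [IsTopologicalGroup E] [SimplyConnectedSpace E] [Group G] [TopologicalSpace G]
    [IsTopologicalGroup G] (q : E →* G) (hq : IsOpenQuotientMap q) (S : Subgroup G)
    (hS : IsDiscrete (S.comap q : Set E)) :
    Nonempty (FundamentalGroup (G ⧸ S) ((1 : G) : G ⧸ S) ≃* S.comap q) := by
  have hquot : Topology.IsQuotientMap ((QuotientGroup.mk : G → G ⧸ S) ∘ q) :=
    QuotientGroup.isOpenQuotientMap_mk.isQuotientMap.comp hq.isQuotientMap
  have hcov : IsQuotientCoveringMap ((QuotientGroup.mk : G → G ⧸ S) ∘ q) (S.comap q).op :=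
    hquot.isQuotientCoveringMap_of_subgroupOp _ hS fun {x y} ↦ by
      simp [QuotientGroup.eq]
  -- Both passages to the opposite group cancel.
  let e : ((S.comap q).op)ᵐᵒᵖ ≃* S.comap q :=
    { toFun x := ⟨x.unop.1.unop, x.unop.2⟩
      invFun x := MulOpposite.op ⟨MulOpposite.op x.1, x.2⟩
      left_inv _ := rfl
      right_inv _ := rfl
      map_mul' _ _ := rfl }
  exact ⟨(hcov.fundamentalGroupEquiv ⟨1, by simp⟩).trans e⟩

/-! ### The exponential and roots of unity -/

/-- The exponential, as a homomorphism from the additive group `ℂ` to `ℂˣ`. -/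
noncomputable def expUnitsHom : Multiplicative ℂ →* ℂˣ where
  toFun z := Units.mk0 (Complex.exp z.toAdd) (Complex.exp_ne_zero _)
  map_one' := by ext; simp
  map_mul' z w := by ext; simp [Complex.exp_add]

theorem coe_expUnitsHom (z : Multiplicative ℂ) :
    (expUnitsHom z : ℂ) = Complex.exp z.toAdd := rfl

theorem isOpenQuotientMap_expUnitsHom : IsOpenQuotientMap expUnitsHom where
  surjective u := ⟨Multiplicative.ofAdd (Complex.log u), by
    ext
    simp [coe_expUnitsHom, Complex.exp_log]⟩
  continuous := Units.isOpenEmbedding_val.continuous_iff.2 <|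
    Complex.continuous_exp.comp continuous_toAdd
  isOpenMap := Units.isOpenEmbedding_val.isOpenMap_iff.2 Complex.isOpenMap_exp

/-- Near `0` the exponential takes the value `1` only at `0`. -/
theorem eventually_expUnitsHom_eq_one :
    ∀ᶠ z in nhds (1 : Multiplicative ℂ), expUnitsHom z = 1 → z = 1 := by
  have hc : Continuous fun z : Multiplicative ℂ ↦ z.toAdd.im :=
    Complex.continuous_im.comp continuous_toAdd
  have h := hc.tendsto 1 (Ioo_mem_nhds (a := -Real.pi) (b := Real.pi)
    (by simp [Real.pi_pos]) (by simp [Real.pi_pos]))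
  filter_upwards [h] with z hz hz1
  have h1 : Complex.exp z.toAdd = 1 := congrArg Units.val hz1
  have h2 := Complex.log_exp hz.1 hz.2.le
  rw [h1, Complex.log_one] at h2
  exact Multiplicative.toAdd.injective h2.symm

/-- If the neutral element is isolated in a subgroup, then the subgroup is discrete. -/
theorem Subgroup.isDiscrete_of_eventually {G : Type*} [Group G] [TopologicalSpace G]
    [IsTopologicalGroup G] (S : Subgroup G) (h : ∀ᶠ x in nhds (1 : G), x ∈ S → x = 1) :
    IsDiscrete (S : Set G) := by
  refine .of_nhdsWithin fun x hx ↦ Filter.le_pure_iff.2 ?_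
  rw [mem_nhdsWithin_iff_eventually]
  have ht : Filter.Tendsto (fun y ↦ x⁻¹ * y) (nhds x) (nhds 1) := by
    simpa using (continuous_const_mul x⁻¹).tendsto x
  filter_upwards [ht.eventually h] with y hy hyS
  exact (inv_mul_eq_one.1 (hy (mul_mem (inv_mem hx) hyS))).symm

/-- By counting, an injective character of a finite group `B` takes as values all roots of unity of
order dividing the cardinality of `B`. -/
theorem range_eq_rootsOfUnity {B : Type*} [Group B] [Finite B] (φ : B →* ℂˣ)
    (hφ : Function.Injective φ) : φ.range = rootsOfUnity (Nat.card B) ℂ := by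
  have : NeZero (Nat.card B) := ⟨Nat.card_pos.ne'⟩
  refine Subgroup.eq_of_le_of_card_ge ?_ ?_
  · rintro _ ⟨b, rfl⟩
    rw [mem_rootsOfUnity, ← map_pow, pow_card_eq_one', map_one]
  · rw [Complex.card_rootsOfUnity]
    exact (Nat.card_congr (MonoidHom.ofInjective hφ).toEquiv).le

/-! ### The deck group -/

section Lift

variable {m n : ℕ} {B : Subgroup (ZMod m)ˣ}

/-- The map `(a, k) ↦ (a, b ^ k)` from `(ℤ/mℤ) ⋊_b ℤ` to `(ℤ/mℤ) ⋊ B`. -/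
def semidirectIntToAffine (b : B) : semidirectInt m (b : (ZMod m)ˣ) →* affineGroup m B :=
  SemidirectProduct.map (MonoidHom.id _) (zpowersHom B b) fun k ↦ by
    have : unitsAction m B b = mulByUnit m b := rfl
    simp [this]

/-- The homomorphism `(a, k) ↦ (α (a, b ^ k), k * w)` from `(ℤ/mℤ) ⋊_b ℤ` to `SL(n, ℂ) × ℂ`. -/
def semidirectIntToCover (α : affineGroup m B →* Matrix.SpecialLinearGroup (Fin n) ℂ) (b : B)
    (w : ℂ) : semidirectInt m (b : (ZMod m)ˣ) →*
      Matrix.SpecialLinearGroup (Fin n) ℂ × Multiplicative ℂ :=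
  (α.comp (semidirectIntToAffine b)).prod
    ((zpowersHom (Multiplicative ℂ) (Multiplicative.ofAdd w)).comp SemidirectProduct.rightHom)

theorem semidirectIntToCover_injective
    {α : affineGroup m B →* Matrix.SpecialLinearGroup (Fin n) ℂ} (hα : Function.Injective α)
    (b : B) {w : ℂ} (hw : w ≠ 0) : Function.Injective (semidirectIntToCover α b w) := by
  intro x y hxy
  have h1 : semidirectIntToAffine b x = semidirectIntToAffine b y :=
    hα (congrArg Prod.fst hxy)
  have hl : x.left = y.left := congrArg (fun h : affineGroup m B ↦ h.left) h1
  have h2 : Multiplicative.ofAdd w ^ x.right.toAdd = Multiplicative.ofAdd w ^ y.right.toAdd :=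
    congrArg Prod.snd hxy
  refine SemidirectProduct.ext hl ?_
  rw [← ofAdd_zsmul, ← ofAdd_zsmul] at h2
  exact Multiplicative.toAdd.injective
    (smul_left_injective ℤ hw (Multiplicative.ofAdd.injective h2))

/-- The preimage of `ψ(H)` in `SL(n, ℂ) × ℂ` consists of the `(α (a, b ^ k), 2πik/r)`, when `b`
is the element that `φ` maps to `exp (2πi/r)`. -/
theorem range_semidirectIntToCover [Finite B]
    (α : affineGroup m B →* Matrix.SpecialLinearGroup (Fin n) ℂ) {φ : B →* ℂˣ}
    (hφ : Function.Injective φ) {b : B}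
    (hb : (φ b : ℂ) = Complex.exp (2 * Real.pi * Complex.I / Nat.card B)) :
    (semidirectIntToCover α b (2 * Real.pi * Complex.I / Nat.card B)).range =
      (psiHom α φ).range.comap (MonoidHom.prodMap (MonoidHom.id _) expUnitsHom) := by
  have hr : (Nat.card B : ℂ) ≠ 0 := Nat.cast_ne_zero.2 Nat.card_pos.ne'
  set w : ℂ := 2 * Real.pi * Complex.I / Nat.card B with hw
  have hexp (k : ℤ) : expUnitsHom (Multiplicative.ofAdd w ^ k) = φ (b ^ k) := by
    rw [map_zpow, map_zpow]
    congr 1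
    ext
    exact hb.symm
  refine le_antisymm ?_ ?_
  · rintro _ ⟨x, rfl⟩
    exact ⟨semidirectIntToAffine b x, Prod.ext rfl (hexp x.right.toAdd).symm⟩
  · rintro ⟨g, z⟩ ⟨h, hh⟩
    have h1 : α h = g := congrArg Prod.fst hh
    have h2 : φ h.right = expUnitsHom z := congrArg Prod.snd hh
    -- The number `exp z` is an `r`-th root of unity, so `z` is a multiple of `2πi/r`.
    obtain ⟨k, hk⟩ : ∃ k : ℤ, (Nat.card B : ℂ) * z.toAdd = k * (2 * Real.pi * Complex.I) := by
      rw [← Complex.exp_eq_one_iff, Complex.exp_nat_mul, ← coe_expUnitsHom, ← h2,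
        ← Units.val_pow_eq_pow_val, ← map_pow, pow_card_eq_one', map_one, Units.val_one]
    have hz : z = Multiplicative.ofAdd w ^ k := by
      rw [← ofAdd_zsmul]
      refine Multiplicative.toAdd.injective ?_
      rw [toAdd_ofAdd, zsmul_eq_mul, hw]
      field_simp
      linear_combination hk
    have hright : h.right = b ^ k := hφ (by rw [h2, hz, hexp])
    refine ⟨⟨h.left, Multiplicative.ofAdd k⟩, Prod.ext ?_ hz.symm⟩
    refine Eq.trans (congrArg α ?_) h1
    exact SemidirectProduct.ext rfl hright.symm

/-- The preimage of `ψ(H)` in `SL(n, ℂ) × ℂ` is discrete: near `1`, finiteness of `H` forces the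
first coordinate to be `1`, injectivity of `α` then makes the exponential of the second equal
to `1`. -/
theorem isDiscrete_comap_range_psiHom [NeZero m]
    {α : affineGroup m B →* Matrix.SpecialLinearGroup (Fin n) ℂ} (hα : Function.Injective α)
    (φ : B →* ℂˣ) :
    IsDiscrete ((psiHom α φ).range.comap (MonoidHom.prodMap (MonoidHom.id _) expUnitsHom) :
      Set (Matrix.SpecialLinearGroup (Fin n) ℂ × Multiplicative ℂ)) := by
  have : Finite (affineGroup m B) := Finite.of_equiv _ SemidirectProduct.equivProd.symm
  refine Subgroup.isDiscrete_of_eventually _ ?_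
  have hfin : (Set.range α \ {1}).Finite := (Set.finite_range α).sdiff
  have h1 : ∀ᶠ g in nhds (1 : Matrix.SpecialLinearGroup (Fin n) ℂ), g ∉ Set.range α \ {1} :=
    hfin.isClosed.isOpen_compl.mem_nhds (by simp)
  rw [Prod.one_eq_mk, nhds_prod_eq]
  filter_upwards [h1.prod_inl _, eventually_expUnitsHom_eq_one.prod_inr _]
  rintro ⟨g, z⟩ hg hz ⟨h, hh⟩
  have hg1 : α h = g := congrArg Prod.fst hh
  have hz1 : φ h.right = expUnitsHom z := congrArg Prod.snd hh
  have hone : g = 1 := by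
    by_contra hne
    exact hg ⟨⟨h, hg1⟩, hne⟩
  have hh1 : h = 1 := hα (by rw [hg1, hone, map_one])
  rw [hh1, SemidirectProduct.one_right, map_one] at hz1
  exact Prod.ext hone (hz hz1.symm)

end Lift

theorem propositionp (m : ℕ) (hm : 0 < m) (B : Subgroup (ZMod m)ˣ) (hB : IsCyclic B)
    (r : ℕ) (hr : Nat.card B = r) (n : ℕ)
    (α : affineGroup m B →* Matrix.SpecialLinearGroup (Fin n) ℂ) (hα : Function.Injective α)
    (φ : B →* ℂˣ) (hφ : Function.Injective φ) :
    ∃ b : B, ((φ b : ℂˣ) : ℂ) = Complex.exp (2 * (Real.pi : ℂ) * Complex.I / (r : ℂ)) ∧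
      Nonempty
        (FundamentalGroup (ambientGroup n ⧸ (psiHom α φ).range)
            ((1 : ambientGroup n) : ambientGroup n ⧸ (psiHom α φ).range) ≃*
          semidirectInt m (b : (ZMod m)ˣ)) := by
  subst hr
  have : NeZero m := ⟨hm.ne'⟩
  have hr : (Nat.card B : ℂ) ≠ 0 := Nat.cast_ne_zero.2 Nat.card_pos.ne'
  set w : ℂ := 2 * Real.pi * Complex.I / Nat.card B with hw
  have hroot : expUnitsHom (Multiplicative.ofAdd w) ∈ φ.range := by
    rw [range_eq_rootsOfUnity φ hφ, mem_rootsOfUnity]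
    ext
    rw [Units.val_pow_eq_pow_val, coe_expUnitsHom, toAdd_ofAdd, ← Complex.exp_nat_mul, hw,
      mul_div_cancel₀ _ hr, Complex.exp_two_pi_mul_I, Units.val_one]
  obtain ⟨b, hb⟩ := hroot
  have hb' : (φ b : ℂ) = Complex.exp w := congrArg Units.val hb
  refine ⟨b, hb', ?_⟩
  have := simplyConnectedSpace_specialLinearGroup_prod (Fin n)
  obtain ⟨e⟩ := nonempty_fundamentalGroup_quotient_mulEquiv
    (MonoidHom.prodMap (MonoidHom.id (Matrix.SpecialLinearGroup (Fin n) ℂ)) expUnitsHom)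
    (IsOpenQuotientMap.id.prodMap isOpenQuotientMap_expUnitsHom) (psiHom α φ).range
    (isDiscrete_comap_range_psiHom hα φ)
  have hw0 : w ≠ 0 := div_ne_zero Complex.two_pi_I_ne_zero hr
  exact ⟨e.trans ((MulEquiv.subgroupCongr (range_semidirectIntToCover α hφ hb').symm).trans
    (MonoidHom.ofInjective (semidirectIntToCover_injective hα b hw0)).symm)⟩
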